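/- For every real $x$ with $0 < x < 1$, the integral below converges absolutely and $$\sin(2\pi x)\int_0^1 \frac{\log\log(1/u)}{1-2u\cos(2\pi x)+u^2}\,du = \frac{\pi}{2}\log\frac{\pi}{\sin(\pi x)} + \frac{\pi}{2}(1-2x)\log(2\pi) - \pi\log\Gamma(x).$$ In particular (the cases $x=1/4$ and $x=1/6$), with absolutely convergent integrals, $$\int_0^1 \frac{\log\log(1/u)}{1+u^2}\,du = \frac{3}{4}\pi\log\pi + \frac{1}{2}\pi\log 2 - \pi\log\Gamma\left(\frac14\right),$$ $$\frac{\sqrt3}{2}\int_0^1 \frac{\log\log(1/u)}{1-u+u^2}\,du = \frac{5}{6}\pi\log(2\pi) - \pi\log\Gamma\left(\frac16\right).$$ -/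

import Mathlib

open Real Set Filter Topology MeasureTheory

/-! Substituting `u = exp (-t)` turns the integral into that of `log t / (2 * (cosh t - cos (2πx)))`
over `t > 0`. After multiplication by `sin (2πx)` the weight is half the real part of `cot (πx +
it/2)`, so Euler's partial fractions expand it into Cauchy kernels of widths `2π(n + x)` and, with a
minus sign, `2π(n + 1 - x)`. A kernel of width `b` integrates against `log t` to `π/2 * log b`.
Summing these logarithms gives `log (Γ(1 - x) / Γ(x))` by Euler's limit for Gamma, and the
reflection formula eliminates `Γ(1 - x)`.

The integrals of the bare differences decay only like `1/n`. The telescoping correction in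
`kernelTerm` vanishes in the pointwise limit, yet makes the interchange of sum and integral
legitimate (`abs_kernelTerm_le`); after integration it supplies the `log N` of Euler's limit and the
`log (2π)` term. -/

/-- The (unnormalised) Cauchy kernel `b / (t² + b²)` of width `b`. -/
noncomputable def cauchyKernel (b t : ℝ) : ℝ := b / (t ^ 2 + b ^ 2)

/-! ### Logarithmic moments of the Cauchy kernel -/

lemma integrableOn_log_div_one_add_sq :
    IntegrableOn (fun t : ℝ => log t / (1 + t ^ 2)) (Ioi 0) := by
  rw [← Ioc_union_Ioi_eq_Ioi zero_le_one]
  refine IntegrableOn.union ?_ ?_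
  · have h : IntervalIntegrable log volume 0 1 := intervalIntegral.intervalIntegrable_log'
    have h2 := h.mul_continuousOn (g := fun t : ℝ => (1 + t ^ 2)⁻¹) (by
      refine Continuous.continuousOn (Continuous.inv₀ (by fun_prop) fun t => by positivity))
    rw [intervalIntegrable_iff_integrableOn_Ioc_of_le zero_le_one] at h2
    exact h2
  · have h := (integrableOn_Ioi_rpow_of_lt (a := -(3 / 2)) (by norm_num) one_pos).const_mul 2
    refine h.mono' (Measurable.aestronglyMeasurable (by fun_prop)) ?_
    filter_upwards [ae_restrict_mem measurableSet_Ioi] with t ht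
    have ht1 : 1 < t := ht
    have ht0 : 0 < t := by linarith
    have hl := log_le_rpow_div ht0.le (ε := 1 / 2) (by norm_num)
    rw [norm_of_nonneg (div_nonneg (log_nonneg ht1.le) (by positivity)), div_le_iff₀ (by positivity)]
    calc log t ≤ 2 * t ^ (1 / 2 : ℝ) := by linarith
      _ = 2 * t ^ (-(3 / 2) : ℝ) * t ^ 2 := by
        rw [mul_assoc, ← rpow_natCast t 2, ← rpow_add ht0]; norm_num
      _ ≤ 2 * t ^ (-(3 / 2) : ℝ) * (1 + t ^ 2) := by gcongr; linarith

/-- The inversion `t ↦ 1/t` preserves `dt / (1 + t²)` and changes the sign of `log t`. -/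
lemma integral_log_div_one_add_sq : ∫ t in Ioi (0 : ℝ), log t / (1 + t ^ 2) = 0 := by
  have h := integral_comp_rpow_Ioi (fun t : ℝ => log t / (1 + t ^ 2)) (p := -1) (by norm_num)
  have h2 : ∫ x in Ioi (0 : ℝ), (|(-1 : ℝ)| * x ^ ((-1 : ℝ) - 1)) •
      (log (x ^ (-1 : ℝ)) / (1 + (x ^ (-1 : ℝ)) ^ 2)) =
      ∫ x in Ioi (0 : ℝ), -(log x / (1 + x ^ 2)) := by
    refine setIntegral_congr_fun measurableSet_Ioi fun t ht => ?_
    have ht0 : 0 < t := ht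
    have e : t ^ ((-1 : ℝ) - 1) = (t ^ 2)⁻¹ := by
      rw [← rpow_natCast t 2, ← rpow_neg ht0.le]; norm_num
    simp only [e, rpow_neg_one, log_inv, smul_eq_mul, abs_neg, abs_one, one_mul]
    field_simp
    ring
  rw [h2, integral_neg] at h
  linarith

lemma log_mul_cauchyKernel_mul {b s : ℝ} (hb : 0 < b) (hs : 0 < s) :
    log (b * s) * cauchyKernel b (b * s) =
      b⁻¹ * (log b * (1 + s ^ 2)⁻¹ + log s / (1 + s ^ 2)) := by
  rw [log_mul hb.ne' hs.ne', cauchyKernel]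
  field_simp
  ring

lemma integrableOn_log_mul_cauchyKernel {b : ℝ} (hb : 0 < b) :
    IntegrableOn (fun t => log t * cauchyKernel b t) (Ioi 0) := by
  have h := integrableOn_Ioi_comp_mul_left_iff (fun t => log t * cauchyKernel b t) 0 hb
  rw [mul_zero] at h
  rw [← h]
  refine IntegrableOn.congr_fun (f := fun s => b⁻¹ * (log b * (1 + s ^ 2)⁻¹ + log s / (1 + s ^ 2)))
    ?_ (fun s hs => (log_mul_cauchyKernel_mul hb hs).symm) measurableSet_Ioi
  exact ((integrable_inv_one_add_sq.integrableOn.const_mul _).add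
    integrableOn_log_div_one_add_sq).const_mul _

lemma integral_log_mul_cauchyKernel {b : ℝ} (hb : 0 < b) :
    ∫ t in Ioi (0 : ℝ), log t * cauchyKernel b t = π / 2 * log b := by
  have h := integral_comp_mul_left_Ioi' (fun t => log t * cauchyKernel b t) 0 hb
  rw [mul_zero] at h
  rw [← h, setIntegral_congr_fun measurableSet_Ioi fun s hs => log_mul_cauchyKernel_mul hb hs,
    integral_const_mul, integral_add (integrable_inv_one_add_sq.integrableOn.const_mul _)
    integrableOn_log_div_one_add_sq, integral_const_mul, integral_Ioi_inv_one_add_sq,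
    integral_log_div_one_add_sq, arctan_zero, smul_eq_mul]
  field_simp
  ring

/-! ### Cotangent as a sum of Cauchy kernels -/

lemma re_inv_add_mul_I (b t : ℝ) : ((b + t * Complex.I : ℂ)⁻¹).re = cauchyKernel b t := by
  simp [Complex.inv_re, Complex.normSq_apply, cauchyKernel]
  ring

lemma tendsto_cauchyKernel_atTop (t : ℝ) {b : ℕ → ℝ} (hb : Tendsto b atTop atTop) :
    Tendsto (fun n => cauchyKernel (b n) t) atTop (𝓝 0) := by
  refine squeeze_zero_norm' ?_ (tendsto_inv_atTop_zero.comp hb)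
  filter_upwards [hb.eventually_gt_atTop 0] with n hn
  rw [cauchyKernel, norm_of_nonneg (by positivity), Function.comp, div_le_iff₀ (by positivity)]
  field_simp
  nlinarith [sq_nonneg t]

/-- The difference of the Cauchy kernels at `2π(n + x)` and `2π(n + 1 - x)`, with a telescoping
correction that makes the sum over `n` converge absolutely. -/
noncomputable def kernelTerm (x : ℝ) (n : ℕ) (t : ℝ) : ℝ :=
  cauchyKernel (2 * π * (n + x)) t - cauchyKernel (2 * π * (n + 1 - x)) t +
    (1 - 2 * x) * (cauchyKernel (2 * π * (n + 1)) t - cauchyKernel (2 * π * n) t)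

lemma le_norm_add_mul_I {b c t : ℝ} (h0 : 0 ≤ c) (h : c ≤ b) :
    t ^ 2 + c ^ 2 ≤ ‖(b + t * Complex.I : ℂ)‖ ^ 2 := by
  rw [← Complex.normSq_eq_norm_sq, Complex.normSq_add_mul_I]
  nlinarith

/-- The term is the real part of a combination of four reciprocals `zᵢ⁻¹`. Since `z₁ + z₂ = z₃ +
z₄`, the difference `z₃z₄ - z₁z₂` is constant, so the common numerator is free of `n` and `t` over a
quartic denominator. -/
lemma abs_kernelTerm_le {x : ℝ} (h0 : 0 < x) (h1 : x < 1) (n : ℕ) (t : ℝ) :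
    |kernelTerm x (n + 1) t| ≤ 2 * π ^ 3 * ((1 + t ^ 2)⁻¹ * (1 / (n + 1 : ℝ) ^ 2)) := by
  have hπ := pi_gt_three
  set c : ℝ := n + 1 with hc
  have hc1 : 1 ≤ c := by simp [hc]
  set z₁ : ℂ := ((2 * π * (c + x) : ℝ) : ℂ) + t * Complex.I with hz₁
  set z₂ : ℂ := ((2 * π * (c + 1 - x) : ℝ) : ℂ) + t * Complex.I with hz₂
  set z₃ : ℂ := ((2 * π * (c + 1) : ℝ) : ℂ) + t * Complex.I with hz₃
  set z₄ : ℂ := ((2 * π * c : ℝ) : ℂ) + t * Complex.I with hz₄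
  have key : ∀ b : ℝ, c ≤ b → t ^ 2 + c ^ 2 ≤ ‖(((2 * π * b : ℝ) : ℂ) + t * Complex.I)‖ ^ 2 :=
    fun b hb => le_norm_add_mul_I (by linarith) (by nlinarith)
  have n₁ := key (c + x) (by linarith)
  have n₂ := key (c + 1 - x) (by linarith)
  have n₃ := key (c + 1) (by linarith)
  have n₄ := key c le_rfl
  have hpos : 0 < t ^ 2 + c ^ 2 := by positivity
  have hne : ∀ z : ℂ, t ^ 2 + c ^ 2 ≤ ‖z‖ ^ 2 → z ≠ 0 := by
    rintro z hz rfl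
    simp at hz
    linarith
  have e₁ := hne _ n₁
  have e₂ := hne _ n₂
  have e₃ := hne _ n₃
  have e₄ := hne _ n₄
  rw [← hz₁] at n₁ e₁
  rw [← hz₂] at n₂ e₂
  rw [← hz₃] at n₃ e₃
  rw [← hz₄] at n₄ e₄
  have hid : z₁⁻¹ - z₂⁻¹ + (1 - 2 * x : ℝ) * (z₃⁻¹ - z₄⁻¹) =
      (2 * π * (1 - 2 * x) * (π ^ 2 * ((1 - 2 * x) ^ 2 - 1)) : ℝ) / (z₁ * z₂ * z₃ * z₄) := by
    field_simp
    rw [hz₁, hz₂, hz₃, hz₄]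
    push_cast
    ring
  have hre : kernelTerm x (n + 1) t =
      (z₁⁻¹ - z₂⁻¹ + (1 - 2 * x : ℝ) * (z₃⁻¹ - z₄⁻¹)).re := by
    rw [Complex.add_re, Complex.sub_re, Complex.re_ofReal_mul, Complex.sub_re, hz₁, hz₂, hz₃, hz₄]
    simp only [re_inv_add_mul_I, kernelTerm, hc]
    push_cast
    rfl
  rw [hre, hid]
  refine (Complex.abs_re_le_norm _).trans ?_
  rw [norm_div, Complex.norm_real]
  have hnum : ‖(2 * π * (1 - 2 * x) * (π ^ 2 * ((1 - 2 * x) ^ 2 - 1)))‖ ≤ 2 * π ^ 3 := by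
    have a1 : |1 - 2 * x| ≤ 1 := abs_le.2 ⟨by linarith, by linarith⟩
    have a2 : |(1 - 2 * x) ^ 2 - 1| ≤ 1 := abs_le.2 ⟨by nlinarith, by nlinarith⟩
    rw [norm_eq_abs, show 2 * π * (1 - 2 * x) * (π ^ 2 * ((1 - 2 * x) ^ 2 - 1)) =
      2 * π ^ 3 * ((1 - 2 * x) * ((1 - 2 * x) ^ 2 - 1)) by ring, abs_mul, abs_mul (1 - 2 * x),
      abs_of_pos (by positivity : 0 < 2 * π ^ 3)]
    exact mul_le_of_le_one_right (by positivity) (mul_le_one₀ a1 (abs_nonneg _) a2)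
  have hden : (1 + t ^ 2) * c ^ 2 ≤ ‖z₁ * z₂ * z₃ * z₄‖ := by
    have hq : ∀ a b : ℂ, t ^ 2 + c ^ 2 ≤ ‖a‖ ^ 2 → t ^ 2 + c ^ 2 ≤ ‖b‖ ^ 2 →
        t ^ 2 + c ^ 2 ≤ ‖a * b‖ := by
      intro a b ha hb
      rw [norm_mul]
      refine le_of_sq_le_sq ?_ (by positivity)
      rw [mul_pow, sq (t ^ 2 + c ^ 2)]
      exact mul_le_mul ha hb hpos.le (by positivity)
    rw [mul_assoc, norm_mul]
    exact (mul_le_mul (by nlinarith : 1 + t ^ 2 ≤ t ^ 2 + c ^ 2)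
      (by nlinarith : c ^ 2 ≤ t ^ 2 + c ^ 2) (by positivity) hpos.le).trans
      (mul_le_mul (hq _ _ n₁ n₂) (hq _ _ n₃ n₄) hpos.le (norm_nonneg _))
  calc _ ≤ 2 * π ^ 3 / ((1 + t ^ 2) * c ^ 2) := by gcongr
    _ = _ := by field_simp

lemma summable_kernelTerm {x : ℝ} (h0 : 0 < x) (h1 : x < 1) (t : ℝ) :
    Summable fun n => kernelTerm x n t := by
  rw [← summable_nat_add_iff 1]
  refine Summable.of_norm_bounded ?_ fun n => abs_kernelTerm_le h0 h1 n t
  have := (summable_nat_add_iff 1).2 (Real.summable_one_div_nat_pow.2 one_lt_two)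
  push_cast at this
  exact (this.mul_left _).mul_left _

lemma re_cot (p q : ℝ) (h : sin p ≠ 0) :
    (Complex.cot (p + q * Complex.I)).re = sin (2 * p) / (cosh (2 * q) - cos (2 * p)) := by
  have hc : 0 < cosh (2 * q) - cos (2 * p) := by
    rw [cos_two_mul, cosh_two_mul, cos_sq', cosh_sq]
    have := sq_pos_of_ne_zero h
    nlinarith [sq_nonneg (sinh q)]
  have hd : 0 < (sin p * cosh q) ^ 2 + (cos p * sinh q) ^ 2 := by
    have := cosh_pos q
    positivity
  rw [Complex.cot, Complex.cos_add_mul_I, Complex.sin_add_mul_I, Complex.div_re]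
  simp only [← Complex.ofReal_cos, ← Complex.ofReal_sin, ← Complex.ofReal_cosh,
    ← Complex.ofReal_sinh, ← Complex.ofReal_mul, Complex.sub_re, Complex.sub_im, Complex.add_re,
    Complex.add_im, Complex.ofReal_re, Complex.ofReal_im, Complex.re_ofReal_mul,
    Complex.im_ofReal_mul, Complex.I_re, Complex.I_im, Complex.normSq_add_mul_I]
  rw [← add_div, div_eq_div_iff hd.ne' hc.ne', sin_two_mul, cos_two_mul, cosh_two_mul]
  have e1 := cosh_sq q
  have e2 := sin_sq p
  ring_nf
  simp only [e1, e2, show cosh q ^ 4 = (cosh q ^ 2) ^ 2 by ring,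
    show sin p ^ 3 = sin p * sin p ^ 2 by ring]
  ring

lemma cauchyKernel_neg (b t : ℝ) : cauchyKernel (-b) t = -cauchyKernel b t := by
  simp [cauchyKernel, neg_div]

lemma cauchyKernel_div (b t : ℝ) {c : ℝ} (hc : c ≠ 0) :
    cauchyKernel b (t / c) = c * cauchyKernel (c * b) t := by
  rw [cauchyKernel, cauchyKernel, show (t / c) ^ 2 + b ^ 2 = (t ^ 2 + (c * b) ^ 2) / c ^ 2 by
    field_simp, div_div_eq_mul_div]
  ring

lemma re_inv_real_add_mul_I (b t : ℝ) :
    ((b + (t / (2 * π) : ℝ) * Complex.I : ℂ)⁻¹).re = 2 * π * cauchyKernel (2 * π * b) t := by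
  rw [re_inv_add_mul_I, cauchyKernel_div _ _ (by positivity)]

/-- `cotTerm` pairs the poles `±(n + 1)`, whereas here `n + x` is paired with `n + 1 - x`; the shift
by one leaves a single boundary kernel. -/
lemma sum_cauchyKernel_sub (x t : ℝ) (N : ℕ) :
    ∑ n ∈ Finset.range N, (cauchyKernel (2 * π * (n + x)) t -
      cauchyKernel (2 * π * (n + 1 - x)) t) =
    (2 * π)⁻¹ * (∑ n ∈ Finset.range N, cotTerm (x + (t / (2 * π) : ℝ) * Complex.I) n +
      (x + (t / (2 * π) : ℝ) * Complex.I : ℂ)⁻¹).re - cauchyKernel (2 * π * (N + x)) t := by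
  induction N with
  | zero =>
    rw [Finset.sum_range_zero, Finset.sum_range_zero, zero_add, re_inv_real_add_mul_I]
    field_simp
    simp
  | succ N ih =>
    have a1 : (1 / ((x + (t / (2 * π) : ℝ) * Complex.I : ℂ) - (N + 1))).re =
        -(2 * π * cauchyKernel (2 * π * (N + 1 - x)) t) := by
      rw [one_div, show (x + (t / (2 * π) : ℝ) * Complex.I : ℂ) - (N + 1) =
        ((-(N + 1 - x) : ℝ) : ℂ) + (t / (2 * π) : ℝ) * Complex.I by push_cast; ring,
        re_inv_real_add_mul_I, mul_neg, cauchyKernel_neg, mul_neg]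
    have a2 : (1 / ((x + (t / (2 * π) : ℝ) * Complex.I : ℂ) + (N + 1))).re =
        2 * π * cauchyKernel (2 * π * (N + 1 + x)) t := by
      rw [one_div, show (x + (t / (2 * π) : ℝ) * Complex.I : ℂ) + (N + 1) =
        ((N + 1 + x : ℝ) : ℂ) + (t / (2 * π) : ℝ) * Complex.I by push_cast; ring,
        re_inv_real_add_mul_I]
    rw [Finset.sum_range_succ, ih, Finset.sum_range_succ, Complex.add_re, Complex.add_re,
      Complex.add_re, cotTerm, Complex.add_re, a1, a2]
    push_cast
    field_simp
    ring

lemma sum_kernelTerm (x : ℝ) (t : ℝ) (N : ℕ) :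
    ∑ n ∈ Finset.range N, kernelTerm x n t =
      ∑ n ∈ Finset.range N, (cauchyKernel (2 * π * (n + x)) t -
        cauchyKernel (2 * π * (n + 1 - x)) t) + (1 - 2 * x) * cauchyKernel (2 * π * N) t := by
  have h := Finset.sum_range_sub (fun n : ℕ => cauchyKernel (2 * π * n) t) N
  push_cast at h
  simp only [kernelTerm]
  rw [Finset.sum_add_distrib, ← Finset.mul_sum, h]
  -- The lower end of the telescope is the kernel of width `0`, which vanishes identically.
  simp [cauchyKernel]

lemma tendsto_two_pi_mul_natCast_add (x : ℝ) :
    Tendsto (fun n : ℕ => 2 * π * (n + x)) atTop atTop :=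
  (tendsto_natCast_atTop_atTop.atTop_add tendsto_const_nhds).const_mul_atTop two_pi_pos

lemma hasSum_kernelTerm {x : ℝ} (h0 : 0 < x) (h1 : x < 1) {t : ℝ} (ht : 0 < t) :
    HasSum (fun n => kernelTerm x n t)
      (sin (2 * π * x) / (2 * (cosh t - cos (2 * π * x)))) := by
  rw [(summable_kernelTerm h0 h1 t).hasSum_iff_tendsto_nat]
  simp only [sum_kernelTerm, sum_cauchyKernel_sub]
  set w : ℂ := x + (t / (2 * π) : ℝ) * Complex.I with hw
  have hwm : w ∈ Complex.integerComplement := by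
    rintro ⟨m, hm⟩
    have := congrArg Complex.im hm
    have hne : t / (2 * π) ≠ 0 := by positivity
    rw [hw, Complex.add_im, Complex.ofReal_im, Complex.im_ofReal_mul, Complex.I_im,
      Complex.intCast_im, mul_one, zero_add] at this
    exact hne this.symm
  have hs : sin (π * x) ≠ 0 := (sin_pos_of_pos_of_lt_pi (by positivity) (by nlinarith [pi_pos])).ne'
  have e : π * w = ((π * x : ℝ) : ℂ) + (t / 2 : ℝ) * Complex.I := by
    have : (π : ℂ) ≠ 0 := by exact_mod_cast pi_ne_zero
    rw [hw]
    push_cast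
    field_simp
  have T := ((Complex.continuous_re.tendsto _).comp
    ((tendsto_logDeriv_euler_cot_sub hwm).add_const w⁻¹)).const_mul (2 * π)⁻¹
  have T2 := tendsto_cauchyKernel_atTop t (tendsto_two_pi_mul_natCast_add x)
  have T3 := tendsto_cauchyKernel_atTop t (tendsto_two_pi_mul_natCast_add 0)
  simp only [add_zero] at T3
  convert! (T.sub T2).add (T3.const_mul (1 - 2 * x)) using 2
  rw [one_div, sub_add_cancel, Complex.re_ofReal_mul, e, re_cot _ _ hs]
  field_simp
  ring_nf

/-! ### Termwise integration and the Gamma limit -/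

lemma integral_log_mul_kernelTerm {x : ℝ} (h0 : 0 < x) (h1 : x < 1) (n : ℕ) :
    IntegrableOn (fun t => log t * kernelTerm x n t) (Ioi 0) ∧
    ∫ t in Ioi (0 : ℝ), log t * kernelTerm x n t =
      π / 2 * (log (2 * π * (n + x)) - log (2 * π * (n + 1 - x)) +
        (1 - 2 * x) * (log (2 * π * (n + 1)) - log (2 * π * n))) := by
  have hn : (0 : ℝ) ≤ n := n.cast_nonneg
  have key : ∀ b : ℝ, 0 ≤ b → IntegrableOn (fun t => log t * cauchyKernel b t) (Ioi 0) ∧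
      ∫ t in Ioi (0 : ℝ), log t * cauchyKernel b t = π / 2 * log b := by
    intro b hb
    rcases hb.eq_or_lt with rfl | hb
    -- Width `0` occurs at `n = 0`; both sides are zero because `log 0 = 0`.
    · simp [cauchyKernel]
    · exact ⟨integrableOn_log_mul_cauchyKernel hb, integral_log_mul_cauchyKernel hb⟩
  obtain ⟨i1, e1⟩ := key (2 * π * (n + x)) (by positivity)
  obtain ⟨i2, e2⟩ := key (2 * π * (n + 1 - x)) (by have : 0 ≤ n + 1 - x := by linarith
                                                   positivity)
  obtain ⟨i3, e3⟩ := key (2 * π * (n + 1)) (by positivity)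
  obtain ⟨i4, e4⟩ := key (2 * π * n) (by positivity)
  have hf : (fun t => log t * kernelTerm x n t) = fun t =>
      (log t * cauchyKernel (2 * π * (n + x)) t - log t * cauchyKernel (2 * π * (n + 1 - x)) t) +
      (1 - 2 * x) * (log t * cauchyKernel (2 * π * (n + 1)) t -
        log t * cauchyKernel (2 * π * n) t) := by
    ext t
    rw [kernelTerm]
    ring
  rw [hf]
  refine ⟨(i1.sub i2).add ((i3.sub i4).const_mul _), ?_⟩
  have s1 := integral_sub i1 i2
  have s2 := integral_sub i3 i4
  have s3 := integral_add (i1.sub i2) ((i3.sub i4).const_mul (1 - 2 * x))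
  simp only [Pi.sub_apply] at s3
  rw [s3, integral_const_mul, s1, s2, e1, e2, e3, e4]
  ring

lemma hasSum_integral_log_mul_kernelTerm {x : ℝ} (h0 : 0 < x) (h1 : x < 1) :
    HasSum (fun n => ∫ t in Ioi (0 : ℝ), log t * kernelTerm x n t)
      (∫ t in Ioi (0 : ℝ), log t * (sin (2 * π * x) / (2 * (cosh t - cos (2 * π * x))))) := by
  have h := hasSum_integral_of_summable_integral_norm (μ := volume.restrict (Ioi 0))
    (F := fun n t => log t * kernelTerm x n t)
    (fun n => (integral_log_mul_kernelTerm h0 h1 n).1) ?_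
  · rwa [setIntegral_congr_fun (measurableSet_Ioi (a := (0 : ℝ))) fun t ht =>
      ((hasSum_kernelTerm h0 h1 ht).mul_left (log t)).tsum_eq] at h
  · rw [← summable_nat_add_iff 1]
    have hi := integrableOn_log_div_one_add_sq.norm
    have hs := (summable_nat_add_iff 1).2 (Real.summable_one_div_nat_pow.2 one_lt_two)
    push_cast at hs
    refine Summable.of_nonneg_of_le (f := fun n : ℕ => 2 * π ^ 3 * (1 / (n + 1 : ℝ) ^ 2) *
      ∫ t in Ioi (0 : ℝ), ‖log t / (1 + t ^ 2)‖) (fun n => integral_nonneg fun t => norm_nonneg _) (fun n => ?_)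
      ((hs.mul_left (2 * π ^ 3)).mul_right (∫ t in Ioi (0 : ℝ), ‖log t / (1 + t ^ 2)‖))
    rw [← integral_const_mul]
    refine integral_mono (integral_log_mul_kernelTerm h0 h1 (n + 1)).1.norm (hi.const_mul _)
      fun t => ?_
    have := abs_kernelTerm_le h0 h1 n t
    simp only [norm_mul, norm_div, norm_eq_abs]
    rw [abs_of_pos (by positivity : 0 < 1 + t ^ 2)]
    refine (mul_le_mul_of_nonneg_left this (abs_nonneg _)).trans_eq ?_
    ring

/-- In the difference of Euler's sequences at `1 - x` and `x` the factorials cancel. -/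
lemma tendsto_logGammaSeq_sub {x : ℝ} (h0 : 0 < x) (h1 : x < 1) :
    Tendsto (fun N : ℕ => ∑ n ∈ Finset.range (N + 1), (log (n + x) - log (n + 1 - x)) +
      (1 - 2 * x) * log N) atTop (𝓝 (log (Gamma (1 - x)) - log (Gamma x))) := by
  have a := BohrMollerup.tendsto_log_gamma h0
  have b := BohrMollerup.tendsto_log_gamma (show 0 < 1 - x by linarith)
  refine (b.sub a).congr fun N => ?_
  simp only [BohrMollerup.logGammaSeq]
  rw [Finset.sum_sub_distrib]
  have e1 : ∀ n : ℕ, (1 - x + n) = n + 1 - x := fun n => by ring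
  have e2 : ∀ n : ℕ, x + n = n + x := fun n => by ring
  simp only [e1, e2]
  ring

theorem integral_log_mul_sin_div_cosh_sub_cos {x : ℝ} (h0 : 0 < x) (h1 : x < 1) :
    ∫ t in Ioi (0 : ℝ), log t * (sin (2 * π * x) / (2 * (cosh t - cos (2 * π * x)))) =
      π / 2 * (log (Gamma (1 - x)) - log (Gamma x) + (1 - 2 * x) * log (2 * π)) := by
  have hS := ((hasSum_integral_log_mul_kernelTerm h0 h1).tendsto_sum_nat).comp
    (tendsto_add_atTop_nat 1)
  refine tendsto_nhds_unique hS ?_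
  -- The telescope ends at `log (2π(N + 1))`, Euler's limit at `log N`; the gap tends to zero.
  have hlim := (((tendsto_logGammaSeq_sub h0 h1).add
    (tendsto_log_nat_add_one_sub_log.const_mul (1 - 2 * x))).add_const
    ((1 - 2 * x) * log (2 * π))).const_mul (π / 2)
  rw [mul_zero, add_zero] at hlim
  refine hlim.congr fun N => ?_
  simp only [Function.comp, (integral_log_mul_kernelTerm h0 h1 _).2]
  have h := Finset.sum_range_sub (fun n : ℕ => log (2 * π * n)) (N + 1)
  have e : ∀ n : ℕ, log (2 * π * (n + x)) - log (2 * π * (n + 1 - x)) =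
      log (n + x) - log (n + 1 - x) := by
    intro n
    have hn : (0 : ℝ) ≤ n := n.cast_nonneg
    rw [log_mul two_pi_pos.ne' (by linarith), log_mul two_pi_pos.ne' (by linarith)]
    ring
  push_cast at h
  rw [← Finset.mul_sum, Finset.sum_add_distrib, ← Finset.mul_sum, h,
    log_mul two_pi_pos.ne' (by positivity)]
  simp only [e, mul_zero, log_zero]
  ring

/-! ### The substitution `u = exp (-t)` -/

lemma one_add_sq_div_two_le_cosh (t : ℝ) : 1 + t ^ 2 / 2 ≤ cosh t := by
  have h : |t / 2| ≤ sinh |t / 2| := self_le_sinh_iff.2 (abs_nonneg _)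
  have h2 := pow_le_pow_left₀ (abs_nonneg _) h 2
  rw [sq_abs] at h2
  have h3 := cosh_two_mul |t / 2|
  rw [cosh_sq, ← cosh_abs, abs_mul, abs_abs, ← abs_mul, cosh_abs, mul_div_cancel₀ _ two_ne_zero] at h3
  nlinarith

lemma integrableOn_log_div_cosh_sub {c : ℝ} (hc : c < 1) (hc' : -1 ≤ c) :
    IntegrableOn (fun t => log t / (2 * (cosh t - c))) (Ioi 0) := by
  refine (integrableOn_log_div_one_add_sq.norm.const_mul (2 / (1 - c))).mono'
    (Measurable.aestronglyMeasurable (by fun_prop)) (ae_of_all _ fun t => ?_)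
  have h := one_add_sq_div_two_le_cosh t
  -- `-1 ≤ c` gives `(1 - c) / 4 ≤ 1 / 2`, the coefficient of `t²` in the bound for `cosh`.
  have h2 : (1 - c) / 4 * (1 + t ^ 2) ≤ cosh t - c := by nlinarith [sq_nonneg t]
  have h3 : 0 < 1 - c := by linarith
  have h4 : 0 < (1 - c) / 4 * (1 + t ^ 2) := by positivity
  rw [norm_div, norm_div, norm_of_nonneg (by linarith : 0 ≤ 2 * (cosh t - c)),
    norm_of_nonneg (by positivity : 0 ≤ 1 + t ^ 2)]
  calc ‖log t‖ / (2 * (cosh t - c)) ≤ ‖log t‖ / (2 * ((1 - c) / 4 * (1 + t ^ 2))) := by gcongr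
    _ = _ := by field_simp; ring

lemma image_exp_neg_Ioi : (fun t : ℝ => exp (-t)) '' Ioi 0 = Ioo 0 1 := by
  ext u
  constructor
  · rintro ⟨t, ht, rfl⟩
    exact ⟨exp_pos _, exp_lt_one_iff.2 (neg_lt_zero.2 ht)⟩
  · rintro ⟨h0, h1⟩
    exact ⟨-log u, by simpa using log_neg h0 h1, by simp [exp_log h0]⟩

lemma abs_deriv_smul_log_log_div {c : ℝ} (t : ℝ) :
    |-exp (-t)| • (log (log (1 / exp (-t))) / (1 - 2 * exp (-t) * c + exp (-t) ^ 2)) =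
      log t / (2 * (cosh t - c)) := by
  have h : 1 - 2 * exp (-t) * c + exp (-t) ^ 2 = exp (-t) * (2 * (cosh t - c)) := by
    have : exp (-t) * exp t = 1 := by rw [← exp_add]; simp
    rw [cosh_eq]
    linear_combination -this
  rw [one_div, ← exp_neg, neg_neg, log_exp, abs_neg, abs_of_pos (exp_pos _), h, smul_eq_mul,
    mul_div_assoc', mul_div_mul_left _ _ (exp_pos _).ne']

lemma hasDerivWithinAt_exp_neg (t : ℝ) :
    HasDerivWithinAt (fun t : ℝ => exp (-t)) (-exp (-t)) (Ioi 0) t := by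
  simpa using ((hasDerivAt_neg t).exp).hasDerivWithinAt

lemma injOn_exp_neg : InjOn (fun t : ℝ => exp (-t)) (Ioi 0) :=
  fun _ _ _ _ h => neg_injective (exp_injective h)

lemma intervalIntegrable_log_log_div {c : ℝ} (hc : c < 1) (hc' : -1 ≤ c) :
    IntervalIntegrable (fun u : ℝ => log (log (1 / u)) / (1 - 2 * u * c + u ^ 2)) volume 0 1 := by
  rw [intervalIntegrable_iff_integrableOn_Ioo_of_le zero_le_one, ← image_exp_neg_Ioi,
    integrableOn_image_iff_integrableOn_abs_deriv_smul measurableSet_Ioi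
      (fun t _ => hasDerivWithinAt_exp_neg t) injOn_exp_neg]
  simpa only [abs_deriv_smul_log_log_div] using integrableOn_log_div_cosh_sub hc hc'

lemma integral_log_log_div (c : ℝ) :
    ∫ u in (0 : ℝ)..1, log (log (1 / u)) / (1 - 2 * u * c + u ^ 2) =
      ∫ t in Ioi (0 : ℝ), log t / (2 * (cosh t - c)) := by
  rw [intervalIntegral.integral_of_le zero_le_one, integral_Ioc_eq_integral_Ioo,
    ← image_exp_neg_Ioi, integral_image_eq_integral_abs_deriv_smul measurableSet_Ioi
      (fun t _ => hasDerivWithinAt_exp_neg t) injOn_exp_neg]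
  simp only [abs_deriv_smul_log_log_div]

/-- Malmsten's integral. -/
theorem sin_mul_integral_log_log_div {x : ℝ} (h0 : 0 < x) (h1 : x < 1) :
    sin (2 * π * x) * ∫ u in (0 : ℝ)..1, log (log (1 / u)) / (1 - 2 * u * cos (2 * π * x) + u ^ 2) =
      1 / 2 * π * log (π / sin (π * x)) + 1 / 2 * π * (1 - 2 * x) * log (2 * π) -
        π * log (Gamma x) := by
  have hG := Gamma_pos_of_pos h0
  have hG' := Gamma_pos_of_pos (show 0 < 1 - x by linarith)
  rw [integral_log_log_div, ← integral_const_mul, ← Gamma_mul_Gamma_one_sub,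
    log_mul hG.ne' hG'.ne']
  have h := integral_log_mul_sin_div_cosh_sub_cos h0 h1
  simp only [mul_div_left_comm (log _)] at h
  rw [h]
  ring

lemma cos_two_pi_mul_lt_one {x : ℝ} (h0 : 0 < x) (h1 : x < 1) : cos (2 * π * x) < 1 := by
  have hs : 0 < sin (π * x) := sin_pos_of_pos_of_lt_pi (by positivity) (by nlinarith [pi_pos])
  rw [show 2 * π * x = 2 * (π * x) by ring, cos_two_mul, cos_sq']
  nlinarith

theorem mainTheorem9 :
    (∀ x : ℝ, 0 < x → x < 1 →
      IntervalIntegrable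
        (fun u : ℝ => Real.log (Real.log (1 / u)) /
          (1 - 2 * u * Real.cos (2 * Real.pi * x) + u ^ 2)) MeasureTheory.volume 0 1 ∧
      Real.sin (2 * Real.pi * x) *
          ∫ u in (0 : ℝ)..1, Real.log (Real.log (1 / u)) /
            (1 - 2 * u * Real.cos (2 * Real.pi * x) + u ^ 2) =
        1 / 2 * Real.pi * Real.log (Real.pi / Real.sin (Real.pi * x)) +
          1 / 2 * Real.pi * (1 - 2 * x) * Real.log (2 * Real.pi) -
          Real.pi * Real.log (Real.Gamma x)) ∧
    (IntervalIntegrable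
        (fun u : ℝ => Real.log (Real.log (1 / u)) / (1 + u ^ 2)) MeasureTheory.volume 0 1 ∧
      ∫ u in (0 : ℝ)..1, Real.log (Real.log (1 / u)) / (1 + u ^ 2) =
        3 / 4 * Real.pi * Real.log Real.pi + 1 / 2 * Real.pi * Real.log 2 -
          Real.pi * Real.log (Real.Gamma (1 / 4))) ∧
    (IntervalIntegrable
        (fun u : ℝ => Real.log (Real.log (1 / u)) / (1 - u + u ^ 2)) MeasureTheory.volume 0 1 ∧
      Real.sqrt 3 / 2 * ∫ u in (0 : ℝ)..1, Real.log (Real.log (1 / u)) / (1 - u + u ^ 2) =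
        5 / 6 * Real.pi * Real.log (2 * Real.pi) -
          Real.pi * Real.log (Real.Gamma (1 / 6))) := by
  have main : ∀ x : ℝ, 0 < x → x < 1 → _ ∧ _ := fun x h0 h1 =>
    ⟨intervalIntegrable_log_log_div (cos_two_pi_mul_lt_one h0 h1) (neg_one_le_cos _),
      sin_mul_integral_log_log_div h0 h1⟩
  refine ⟨main, ?_, ?_⟩
  · have h := main (1 / 4) (by norm_num) (by norm_num)
    rw [show 2 * π * (1 / 4) = π / 2 by ring, show π * (1 / 4) = π / 4 by ring, cos_pi_div_two,
      sin_pi_div_two, sin_pi_div_four] at h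
    simp only [mul_zero, sub_zero, one_mul] at h
    refine ⟨h.1, h.2.trans ?_⟩
    rw [log_div pi_ne_zero (by positivity), log_div (by positivity) two_ne_zero, log_sqrt zero_le_two,
      log_mul two_ne_zero pi_ne_zero]
    ring
  · have h := main (1 / 6) (by norm_num) (by norm_num)
    rw [show 2 * π * (1 / 6) = π / 3 by ring, show π * (1 / 6) = π / 6 by ring, cos_pi_div_three,
      sin_pi_div_three, sin_pi_div_six] at h
    have e : ∀ u : ℝ, 1 - 2 * u * (1 / 2) = 1 - u := fun u => by ring
    simp only [e] at h
    refine ⟨h.1, h.2.trans ?_⟩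
    rw [show π / (1 / 2) = 2 * π by ring]
    ring
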